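/- Let $n\ge 0$ be an integer. Alice and Bob share no randomness: each holds only a private random number, uniform on $[0,1)$, and the two numbers are independent. They run an interactive protocol in which bits are sent one at a time; whose turn it is and whether the conversation is over is determined by the bits exchanged so far, and each party's bits and output depend only on its own input, its own random number and the bits exchanged so far. Outputs are produced when the conversation ends, which must happen almost surely on every pair of inputs. All POVMs below have an arbitrary finite number of outcomes (the protocols are not told the other party's number of outcomes in advance). Then the following two tasks can be performed exactly. (a) Classical teleportation of a state of a $2^n$-dimensional Hilbert space. Alice is given an arbitrary unit vector $\psi\in(\mathbb C^2)^{\otimes n}$, Bob is given an arbitrary POVM $\{B_l\}$ on $(\mathbb C^2)^{\otimes n}$, and Bob outputs $l$ with probability $\langle\psi|B_l|\psi\rangle$. (b) Simulation of POVMs on $n$ ebits. Let $\Phi\in(\mathbb C^2)^{\otimes n}\otimes(\mathbb C^2)^{\otimes n}$ be the tensor product of $n$ Bell states $(|00\rangle+|11\rangle)/\sqrt2$, Alice holding the first half and Bob the second half of each. Alice is given an arbitrary POVM $\{A_k\}$ and Bob an arbitrary POVM $\{B_l\}$ on $(\mathbb C^2)^{\otimes n}$; Alice outputs $k$ and Bob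 outputs $l$ with joint probability $\langle\Phi|A_k\otimes B_l|\Phi\rangle$. For each of the two tasks there is a single protocol (depending only on $n$) that performs it on all inputs and such that, for every pair of inputs, the expected total number of bits exchanged is less than $(3n+6)2^n+2$; more specifically, the expected number of bits sent by Alice is less than $(3n+6)2^n$ and the expected number of bits sent by Bob is less than $2$. -/

import Mathlib

open MeasureTheory
open scoped Kronecker ENNReal ComplexOrder

namespace ClassicalSimulation

/-! ### Quantum states and measurements -/

/-- Labels of the computational basis of `n` qubits, a basis of a `2 ^ n`-dimensional space. -/
abbrev Qubits (n : ℕ) : Type := Fin n → Fin 2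

/-- A pure state: a unit vector of the Hilbert space `ℂ^ι`. -/
abbrev PureState (ι : Type) [Fintype ι] : Type :=
  {ψ : EuclideanSpace ℂ ι // ‖ψ‖ = 1}

/-- A positive operator valued measure on `ℂ^ι`, with an arbitrary finite number of outcomes. -/
structure POVM (ι : Type) [Fintype ι] [DecidableEq ι] where
  /-- the number of outcomes -/
  outcomes : ℕ
  /-- the POVM elements -/
  effect : Fin outcomes → Matrix ι ι ℂ
  posSemidef : ∀ l, (effect l).PosSemidef
  sum_effect : ∑ l, effect l = 1

/-- The number `⟨v| M |v⟩`; it is real when `M` is Hermitian. -/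
noncomputable def born {ι : Type} [Fintype ι] (v : ι → ℂ) (M : Matrix ι ι ℂ) : ℝ :=
  (star v ⬝ᵥ (M.mulVec v)).re

/-- The amplitude of `|a⟩|b⟩` in the Bell state `(|00⟩ + |11⟩) / √2`. -/
noncomputable def bellAmplitude (a b : Fin 2) : ℂ :=
  if a = b then 1 / (Real.sqrt 2 : ℂ) else 0

/-- The state of `n` ebits, i.e. the tensor product of `n` Bell states, with the first halves
(Alice's `n` qubits) and the second halves (Bob's `n` qubits) grouped together. -/
noncomputable def ebits (n : ℕ) : Qubits n × Qubits n → ℂ :=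
  fun s => ∏ i, bellAmplitude (s.1 i) (s.2 i)

/-! ### Two-party protocols without shared randomness -/

/-- Who sends the next bit; `halt` means that the conversation is over. -/
inductive Turn : Type
  | alice
  | bob
  | halt

/-- A two-party communication protocol in which bits are sent one at a time. Alice's inputs are
the elements of `X`, Bob's those of `Y`; their outputs lie in `OA x` and `OB y`. Whose turn it is
and whether the conversation is over depends only on the bits exchanged so far, so that only the
bits themselves carry information. Everything a party does depends only on its own input, the
bits exchanged so far and its own private random real number in `[0, 1)`. -/
structure Protocol (X Y : Type) (OA : X → Type) (OB : Y → Type) where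
  /-- who speaks next, given the transcript -/
  turn : List Bool → Turn
  /-- the bit that Alice sends -/
  aliceBit : X → List Bool → ℝ → Bool
  /-- the bit that Bob sends -/
  bobBit : Y → List Bool → ℝ → Bool
  /-- Alice's output, given the final transcript -/
  aliceOut : (x : X) → List Bool → ℝ → OA x
  /-- Bob's output, given the final transcript -/
  bobOut : (y : Y) → List Bool → ℝ → OB y
  measurable_aliceBit : ∀ x h, Measurable (aliceBit x h)
  measurable_bobBit : ∀ y h, Measurable (bobBit y h)
  measurableSet_aliceOut : ∀ x h a, MeasurableSet {r | aliceOut x h r = a}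
  measurableSet_bobOut : ∀ y h b, MeasurableSet {r | bobOut y h r = b}

/-- The law of the pair (Alice's random number, Bob's random number): each is uniform on `[0, 1)`
and they are independent, so the parties share no randomness. -/
noncomputable def privateRandomness : Measure (ℝ × ℝ) :=
  (volume.restrict (Set.Ico 0 1)).prod (volume.restrict (Set.Ico 0 1))

namespace Protocol

variable {X Y : Type} {OA : X → Type} {OB : Y → Type}

/-- The transcript extended by the next bit, if the conversation is not over. -/
def step (p : Protocol X Y OA OB) (x : X) (y : Y) (ω : ℝ × ℝ) (h : List Bool) : List Bool :=
  match p.turn h with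
  | Turn.alice => h ++ [p.aliceBit x h ω.1]
  | Turn.bob => h ++ [p.bobBit y h ω.2]
  | Turn.halt => h

/-- The transcript after `t` steps; it is constant from the end of the conversation on. -/
def transcript (p : Protocol X Y OA OB) (x : X) (y : Y) (ω : ℝ × ℝ) : ℕ → List Bool
  | 0 => []
  | t + 1 => p.step x y ω (p.transcript x y ω t)

open Classical in
/-- The number of bits that Alice sends in the whole conversation, possibly infinite. -/
noncomputable def aliceBits (p : Protocol X Y OA OB) (x : X) (y : Y) (ω : ℝ × ℝ) : ℝ≥0∞ :=
  ∑' t, if p.turn (p.transcript x y ω t) = Turn.alice then 1 else 0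

open Classical in
/-- The number of bits that Bob sends in the whole conversation, possibly infinite. -/
noncomputable def bobBits (p : Protocol X Y OA OB) (x : X) (y : Y) (ω : ℝ × ℝ) : ℝ≥0∞ :=
  ∑' t, if p.turn (p.transcript x y ω t) = Turn.bob then 1 else 0

/-- The average number of bits sent by Alice on the inputs `x`, `y`. -/
noncomputable def avgAliceBits (p : Protocol X Y OA OB) (x : X) (y : Y) : ℝ≥0∞ :=
  ∫⁻ ω, p.aliceBits x y ω ∂privateRandomness

/-- The average number of bits sent by Bob on the inputs `x`, `y`. -/
noncomputable def avgBobBits (p : Protocol X Y OA OB) (x : X) (y : Y) : ℝ≥0∞ :=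
  ∫⁻ ω, p.bobBits x y ω ∂privateRandomness

/-- The average total number of bits exchanged on the inputs `x`, `y`. -/
noncomputable def avgBits (p : Protocol X Y OA OB) (x : X) (y : Y) : ℝ≥0∞ :=
  ∫⁻ ω, (p.aliceBits x y ω + p.bobBits x y ω) ∂privateRandomness

/-- The conversation comes to an end with Alice giving output `a` and Bob giving output `b`. -/
def Outputs (p : Protocol X Y OA OB) (x : X) (y : Y) (ω : ℝ × ℝ) (a : OA x) (b : OB y) : Prop :=
  ∃ t, p.turn (p.transcript x y ω t) = Turn.halt ∧
    p.aliceOut x (p.transcript x y ω t) ω.1 = a ∧ p.bobOut y (p.transcript x y ω t) ω.2 = b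

/-- On all inputs `x`, `y` the conversation ends almost surely, and the outputs are jointly
distributed exactly according to `P x y`. -/
def Simulates (p : Protocol X Y OA OB) (P : (x : X) → (y : Y) → OA x → OB y → ℝ) : Prop :=
  ∀ x y,
    (∀ᵐ ω ∂privateRandomness, ∃ t, p.turn (p.transcript x y ω t) = Turn.halt) ∧
    ∀ a b, privateRandomness.real {ω | p.Outputs x y ω a b} = P x y a b

end Protocol

/-- A protocol for classical teleportation of `n`-qubit states: Alice is given a pure state, Bob
is given a POVM, and Bob alone outputs an outcome. -/
abbrev TeleportationProtocol (n : ℕ) : Type :=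
  Protocol (PureState (Qubits n)) (POVM (Qubits n)) (fun _ => Unit) (fun N => Fin N.outcomes)

/-- A protocol for classical entanglement simulation on `n` ebits: each party is given a POVM on
its own `n` qubits and outputs an outcome of it. -/
abbrev EbitProtocol (n : ℕ) : Type :=
  Protocol (POVM (Qubits n)) (POVM (Qubits n))
    (fun M => Fin M.outcomes) (fun N => Fin N.outcomes)

/-- The outcome distribution `⟨ψ| B_l |ψ⟩` of Bob's measurement of the teleported state. -/
noncomputable def teleportationLaw (n : ℕ) (ψ : PureState (Qubits n)) (N : POVM (Qubits n))
    (_ : Unit) (l : Fin N.outcomes) : ℝ :=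
  born ψ.1 (N.effect l)

/-- The joint outcome distribution `⟨Φ| A_k ⊗ B_l |Φ⟩` of local measurements on `n` ebits `Φ`. -/
noncomputable def ebitLaw (n : ℕ) (M N : POVM (Qubits n))
    (k : Fin M.outcomes) (l : Fin N.outcomes) : ℝ :=
  born (ebits n) (M.effect k ⊗ₖ N.effect l)

end ClassicalSimulation

open ClassicalSimulation

/-! Both tasks reduce to remote sampling: Alice knows a pure state `ψ`, and Bob must sample from a
law `p_b = ⟨ψ|B_b|ψ⟩` that he never learns exactly. Alice sends digits of the amplitudes of `ψ`. At
each checkpoint Bob bounds every `p_b` from below by its infimum over all states compatible with the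
digits received. These bounds increase with the checkpoints, and their total mass tends to 1. Bob
uses one uniform number `r` throughout: he stops at the first checkpoint where `r` is below the
mass, and outputs the `b` in whose increment `r` lies. Outcome `b` thus collects the sum of its
increments, which is exactly `p_b`, although each conversation is almost surely finite
(`Scheme.Converges.uniform_outcomeSet`, `Scheme.Converges.prob_outputs`).

If the mass missing after checkpoint `k` is at most `c / 2 ^ k`, the expected number of refusals to
stop is at most `2 * c`, which bounds the communication. `converges_teleportation` gives `c = 3 /
8`. By `le_born` the error for an effect scales with its trace, and the traces of a POVM add up to
`2 ^ n`, so the number of outcomes plays no role.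

For ebits, Alice refines her POVM to rank one and samples a refined outcome alone. This steers Bob's
half to a pure state known to her (`born_ebits`), which is then teleported classically. -/

namespace ClassicalSimulation

/-! ### Sampling from a finite distribution with one uniform random number -/

/-- The interval of length `w b` assigned to `b` when the intervals are laid out from `s` on. -/
def slot {m : ℕ} (s : ℝ) (w : Fin m → ℝ) (b : Fin m) : Set ℝ :=
  Set.Ico (s + ∑ i ∈ Finset.Iio b, w i) (s + ∑ i ∈ Finset.Iic b, w i)

/-- The index of the slot that contains `r`. -/
noncomputable def sample {m : ℕ} (hm : 0 < m) (s : ℝ) (w : Fin m → ℝ) (r : ℝ) : Fin m :=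
  if h : (∑ j : Fin m, if s + ∑ i ∈ Finset.Iic j, w i ≤ r then 1 else 0) < m then ⟨_, h⟩
  else ⟨0, hm⟩

lemma measurable_sample {m : ℕ} (hm : 0 < m) (s : ℝ) (w : Fin m → ℝ) :
    Measurable (sample hm s w) := by
  have h : Measurable fun r : ℝ =>
      (∑ j : Fin m, if s + ∑ i ∈ Finset.Iic j, w i ≤ r then 1 else 0 : ℕ) :=
    Finset.measurable_sum _ fun j _ =>
      Measurable.ite measurableSet_Ici measurable_const measurable_const
  exact (measurable_from_top (f := fun c : ℕ => if h : c < m then (⟨c, h⟩ : Fin m)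
    else ⟨0, hm⟩)).comp h

lemma sum_Iic_eq {m : ℕ} (w : Fin m → ℝ) (b : Fin m) :
    ∑ i ∈ Finset.Iic b, w i = (∑ i ∈ Finset.Iio b, w i) + w b := by
  rw [← Finset.Iio_insert, Finset.sum_insert (by simp), add_comm]

/-- Partial sums of nonnegative weights are monotone, so a point of slot `b` lies beyond the right
ends of exactly the slots before `b`. Counting these ends returns `b`. -/
lemma sample_eq {m : ℕ} (hm : 0 < m) {s : ℝ} {w : Fin m → ℝ} (hw : ∀ i, 0 ≤ w i)
    {r : ℝ} {b : Fin m} (hr : r ∈ slot s w b) : sample hm s w r = b := by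
  have h : ∀ j : Fin m, (s + ∑ i ∈ Finset.Iic j, w i ≤ r) ↔ j < b := by
    intro j
    constructor
    · intro hj
      by_contra! hb
      have := Finset.sum_le_sum_of_subset_of_nonneg (Finset.Iic_subset_Iic.2 hb)
        (fun i _ _ => hw i)
      linarith [hr.2]
    · intro hj
      have : ∑ i ∈ Finset.Iic j, w i ≤ ∑ i ∈ Finset.Iio b, w i := by
        refine Finset.sum_le_sum_of_subset_of_nonneg ?_ (fun i _ _ => hw i)
        intro i hi
        simp only [Finset.mem_Iic, Finset.mem_Iio] at hi ⊢
        exact hi.trans_lt hj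
      linarith [hr.1]
  have hc : (∑ j : Fin m, if s + ∑ i ∈ Finset.Iic j, w i ≤ r then 1 else 0) = (b : ℕ) := by
    simp only [h, Finset.sum_boole, Nat.cast_id]
    rw [show (Finset.univ.filter fun j : Fin m => j < b) = Finset.Iio b by ext; simp]
    simp
  unfold sample
  simp only [hc, b.2, dif_pos]

lemma volume_slot {m : ℕ} (s : ℝ) (w : Fin m → ℝ) (b : Fin m) :
    volume (slot s w b) = ENNReal.ofReal (w b) := by
  rw [slot, Real.volume_Ico, sum_Iic_eq]
  congr 1
  ring

lemma slot_subset {m : ℕ} (s : ℝ) {w : Fin m → ℝ} (hw : ∀ i, 0 ≤ w i) (b : Fin m) :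
    slot s w b ⊆ Set.Ico s (s + ∑ i, w i) := by
  refine Set.Ico_subset_Ico ?_ ?_
  · linarith [Finset.sum_nonneg fun i (_ : i ∈ Finset.Iio b) => hw i]
  · linarith [Finset.sum_le_sum_of_subset_of_nonneg (Finset.subset_univ (Finset.Iic b))
      (fun i _ _ => hw i)]

/-- The uniform distribution on `[0, 1)`. -/
noncomputable abbrev uniform : Measure ℝ := volume.restrict (Set.Ico 0 1)

instance : IsProbabilityMeasure uniform := ⟨by simp [uniform]⟩

/-- Disjoint events whose probabilities are bounded below by a distribution have exactly that
distribution. -/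
lemma measure_eq_of_le {m : ℕ} {μ : Measure ℝ} [IsProbabilityMeasure μ] {O : Fin m → Set ℝ}
    (hO : ∀ b, MeasurableSet (O b)) (hd : Pairwise (Function.onFun Disjoint O)) {p : Fin m → ℝ}
    (hs : ∑ b, p b = 1) (hle : ∀ b, ENNReal.ofReal (p b) ≤ μ (O b))
    (b : Fin m) : μ (O b) = ENNReal.ofReal (p b) := by
  have hreal : ∀ b, p b ≤ μ.real (O b) := fun b =>
    (ENNReal.ofReal_le_iff_le_toReal (measure_ne_top _ _)).1 (hle b)
  have hsum : ∑ b, μ.real (O b) ≤ 1 := by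
    rw [← measureReal_biUnion_finset (fun i _ j _ hij => hd hij) (fun b _ => hO b)]
    exact measureReal_le_one
  -- Termwise inequalities between families whose totals are forced to agree are equalities.
  have heq := (Finset.sum_eq_sum_iff_of_le fun b _ => hreal b).1
    (le_antisymm (Finset.sum_le_sum fun b _ => hreal b) (hsum.trans hs.ge)) b (Finset.mem_univ b)
  rw [heq, ofReal_measureReal]

lemma uniform_sample {m : ℕ} (hm : 0 < m) {w : Fin m → ℝ} (hw : ∀ i, 0 ≤ w i)
    (hs : ∑ i, w i = 1) (b : Fin m) :
    uniform {r | sample hm 0 w r = b} = ENNReal.ofReal (w b) := by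
  refine measure_eq_of_le (O := fun b => {r | sample hm 0 w r = b})
    (fun b => measurable_sample hm 0 w (measurableSet_singleton b)) ?_ hs ?_ b
  · intro i j hij
    refine Set.disjoint_left.2 fun r hi hj => hij ?_
    exact Eq.trans (Eq.symm hi) hj
  · intro b
    have hmeas : MeasurableSet {r | sample hm 0 w r = b} :=
      measurable_sample hm 0 w (measurableSet_singleton b)
    rw [← volume_slot 0 w b, uniform, Measure.restrict_apply hmeas]
    refine measure_mono fun r hr => ⟨sample_eq hm hw hr, ?_⟩
    have := slot_subset 0 hw b hr
    rwa [hs, zero_add] at this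


/-! ### Remote sampling by successive refinement -/

/-- The data of a remote sampling task: a state `s` is described by the bits `code s`, and
Bob has to sample from `law s y`. Bob may interrupt the description after `first` bits and then
after every further `gap` bits; the bits `code s i` at the interruption points `i` are not used. -/
structure Scheme (S Y : Type) (m : Y → ℕ) where
  code : S → ℕ → Bool
  law : S → (y : Y) → Fin (m y) → ℝ
  law_nonneg : ∀ s y b, 0 ≤ law s y b
  sum_law : ∀ s y, ∑ b, law s y b = 1
  pos : ∀ y, 0 < m y
  first : ℕ
  gap : ℕ

/-- A finite random choice of a state and of an output, made locally by Alice. -/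
structure LocalChoice (X S : Type) (OA : X → Type) where
  size : X → ℕ
  choice : (x : X) → ℝ → Fin (size x)
  measurable_choice : ∀ x, Measurable (choice x)
  state : (x : X) → Fin (size x) → S
  out : (x : X) → Fin (size x) → OA x

/-- The first `t` bits of an infinite sequence. -/
def initialBits (f : ℕ → Bool) (t : ℕ) : List Bool := (List.range t).map f

/-- The bit of a transcript at a given position. -/
def bitAt (h : List Bool) (i : ℕ) : Bool := h.getD i false

@[simp] lemma length_initialBits (f : ℕ → Bool) (t : ℕ) : (initialBits f t).length = t := by
  simp [initialBits]

lemma bitAt_initialBits (f : ℕ → Bool) {t i : ℕ} (hi : i < t) :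
    bitAt (initialBits f t) i = f i := by
  simp [bitAt, initialBits, List.getD, hi]

lemma initialBits_succ (f : ℕ → Bool) (t : ℕ) :
    initialBits f (t + 1) = initialBits f t ++ [f t] := by
  simp [initialBits, List.range_succ]

namespace Scheme

variable {X S Y : Type} {m : Y → ℕ} {OA : X → Type} (P : Scheme S Y m)

/-- The position of Bob's `k`-th bit. -/
def checkpoint (k : ℕ) : ℕ := P.first + k * (P.gap + 1)

/-- The positions of Bob's bits. -/
def IsCheckpoint (i : ℕ) : Prop := ∃ k, i = P.checkpoint k

lemma checkpoint_strictMono : StrictMono P.checkpoint := by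
  refine strictMono_nat_of_lt_succ fun k => ?_
  simp only [checkpoint, add_mul]
  omega

/-- The best lower bound on the law that holds for all states compatible with the first `L` bits
of the conversation. -/
noncomputable def lower (e : ℕ → Bool) (L : ℕ) (y : Y) (b : Fin (m y)) : ℝ :=
  ⨅ s : {s : S // ∀ i < L, ¬ P.IsCheckpoint i → P.code s i = e i}, P.law s y b

/-- The part of the law that Bob knows before his `k`-th checkpoint. -/
noncomputable def settled (e : ℕ → Bool) (y : Y) : ℕ → Fin (m y) → ℝ
  | 0 => 0
  | k + 1 => P.lower e (P.checkpoint k) y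

/-- The total weight of the settled part of the law. -/
noncomputable def mass (e : ℕ → Bool) (y : Y) (k : ℕ) : ℝ := ∑ b, P.settled e y k b

/-- The outcome that Bob announces when he stops at checkpoint `k`. -/
noncomputable def outcome (e : ℕ → Bool) (y : Y) (k : ℕ) (r : ℝ) : Fin (m y) :=
  sample (P.pos y) (P.mass e y k) (fun b => P.settled e y (k + 1) b - P.settled e y k b) r

open Classical in
/-- Alice describes the state bit by bit; Bob stops her as soon as his random number is below the
total weight of the lower bounds. -/
noncomputable def protocol (A : LocalChoice X S OA) : Protocol X Y OA (fun y => Fin (m y)) where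
  turn h :=
    if ∃ k, P.checkpoint k < h.length ∧ bitAt h (P.checkpoint k) = true then Turn.halt
    else if P.IsCheckpoint h.length then Turn.bob else Turn.alice
  aliceBit x h r := P.code (A.state x (A.choice x r)) h.length
  bobBit y h r := decide (r < ∑ b, P.lower (bitAt h) h.length y b)
  aliceOut x _ r := A.out x (A.choice x r)
  -- A finished transcript has length `P.checkpoint k + 1`, from which the quotient recovers `k`.
  bobOut y h r := P.outcome (bitAt h) y ((h.length - 1 - P.first) / (P.gap + 1)) r
  measurable_aliceBit x h :=
    (measurable_from_top (f := fun j => P.code (A.state x j) h.length)).comp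
      (A.measurable_choice x)
  measurable_bobBit y h := by
    refine measurable_to_bool ?_
    simp only [Set.preimage, Set.mem_singleton_iff, decide_eq_true_eq]
    exact measurableSet_Iio
  measurableSet_aliceOut x _ a :=
    A.measurable_choice x (MeasurableSpace.measurableSet_top (s := {j | A.out x j = a}))
  measurableSet_bobOut y h b :=
    measurable_sample _ _ _ (measurableSet_singleton b)

/-! ### Monotonicity of the lower bounds -/

/-- Bob's own bits say nothing about the state. This allows the actual transcript to be replaced by
Alice's code. -/
lemma lower_congr {e e' : ℕ → Bool} {L : ℕ} (h : ∀ i < L, ¬ P.IsCheckpoint i → e i = e' i)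
    (y : Y) : P.lower e L y = P.lower e' L y := by
  have : (fun s => ∀ i < L, ¬ P.IsCheckpoint i → P.code s i = e i) =
      fun s => ∀ i < L, ¬ P.IsCheckpoint i → P.code s i = e' i := by
    funext s
    refine propext (forall₃_congr fun i hi hc => ?_)
    rw [h i hi hc]
  funext b
  unfold lower
  rw [this]

lemma settled_congr {e e' : ℕ → Bool} {k : ℕ}
    (h : ∀ i < P.checkpoint k, ¬ P.IsCheckpoint i → e i = e' i) (y : Y) {j : ℕ}
    (hj : j ≤ k + 1) : P.settled e y j = P.settled e' y j := by
  cases j with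
  | zero => rfl
  | succ j =>
    refine P.lower_congr (fun i hi => h i (hi.trans_le ?_)) y
    exact P.checkpoint_strictMono.monotone (by omega)

lemma bddBelow_law (e : ℕ → Bool) (L : ℕ) (y : Y) (b : Fin (m y)) :
    BddBelow (Set.range fun s : {s : S // ∀ i < L, ¬ P.IsCheckpoint i → P.code s i = e i} =>
      P.law s y b) :=
  ⟨0, by rintro _ ⟨s, rfl⟩; exact P.law_nonneg _ _ _⟩

lemma lower_nonneg (e : ℕ → Bool) (L : ℕ) (y : Y) (b : Fin (m y)) : 0 ≤ P.lower e L y b :=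
  Real.iInf_nonneg fun _ => P.law_nonneg _ _ _

lemma lower_le (s : S) (L : ℕ) (y : Y) (b : Fin (m y)) :
    P.lower (P.code s) L y b ≤ P.law s y b :=
  ciInf_le (P.bddBelow_law _ _ _ _) ⟨s, fun _ _ _ => rfl⟩

lemma le_lower (s : S) (L : ℕ) (y : Y) (b : Fin (m y)) {c : ℝ}
    (h : ∀ s', (∀ i < L, ¬ P.IsCheckpoint i → P.code s' i = P.code s i) → c ≤ P.law s' y b) :
    c ≤ P.lower (P.code s) L y b :=
  haveI : Nonempty {s' : S // ∀ i < L, ¬ P.IsCheckpoint i → P.code s' i = P.code s i} :=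
    ⟨⟨s, fun _ _ _ => rfl⟩⟩
  le_ciInf fun s' => h s'.1 s'.2

lemma lower_mono (s : S) {L L' : ℕ} (h : L ≤ L') (y : Y) (b : Fin (m y)) :
    P.lower (P.code s) L y b ≤ P.lower (P.code s) L' y b :=
  P.le_lower _ _ _ _ fun s' hs' =>
    ciInf_le (P.bddBelow_law _ _ _ _) ⟨s', fun i hi => hs' i (hi.trans_le h)⟩

lemma settled_le_succ (s : S) (y : Y) (k : ℕ) (b : Fin (m y)) :
    P.settled (P.code s) y k b ≤ P.settled (P.code s) y (k + 1) b := by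
  cases k with
  | zero => exact P.lower_nonneg _ _ _ _
  | succ k => exact P.lower_mono _ (P.checkpoint_strictMono.monotone k.le_succ) _ _

lemma settled_le_law (s : S) (y : Y) (k : ℕ) (b : Fin (m y)) :
    P.settled (P.code s) y k b ≤ P.law s y b := by
  cases k with
  | zero => exact P.law_nonneg _ _ _
  | succ k => exact P.lower_le _ _ _ _

lemma mass_mono (s : S) (y : Y) : Monotone (P.mass (P.code s) y) :=
  monotone_nat_of_le_succ fun k => Finset.sum_le_sum fun b _ => P.settled_le_succ s y k b

lemma mass_le_one (s : S) (y : Y) (k : ℕ) : P.mass (P.code s) y k ≤ 1 :=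
  (Finset.sum_le_sum fun b _ => P.settled_le_law s y k b).trans (P.sum_law s y).le

lemma mass_zero (e : ℕ → Bool) (y : Y) : P.mass e y 0 = 0 := by simp [mass, settled]

lemma mass_nonneg (s : S) (y : Y) (k : ℕ) : 0 ≤ P.mass (P.code s) y k :=
  (P.mass_zero (P.code s) y).ge.trans (P.mass_mono s y k.zero_le)

open Classical in
/-- The bits that are exchanged if the conversation never ends. -/
noncomputable def stream (s : S) (y : Y) (r : ℝ) (i : ℕ) : Bool :=
  if P.IsCheckpoint i then decide (r < ∑ b, P.lower (P.code s) i y b) else P.code s i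

lemma stream_checkpoint (s : S) (y : Y) (r : ℝ) (k : ℕ) :
    P.stream s y r (P.checkpoint k) = true ↔ r < P.mass (P.code s) y (k + 1) := by
  rw [stream, if_pos ⟨k, rfl⟩, decide_eq_true_eq]
  rfl

lemma stream_of_not (s : S) (y : Y) (r : ℝ) {i : ℕ} (hi : ¬ P.IsCheckpoint i) :
    P.stream s y r i = P.code s i := if_neg hi

/-- Bob does not stop at the first `k` checkpoints. -/
def Runs (s : S) (y : Y) (r : ℝ) (k : ℕ) : Prop := ∀ j < k, P.mass (P.code s) y (j + 1) ≤ r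

/-! ### Transcripts of the refinement protocol -/

section transcript

variable (A : LocalChoice X S OA) (x : X) (y : Y) (ω : ℝ × ℝ)

/-- The state that Alice describes. -/
def chosen : S := A.state x (A.choice x ω.1)

lemma turn_initialBits (s : S) (r : ℝ) (t : ℕ)
    (h : ∀ k, P.checkpoint k < t → P.mass (P.code s) y (k + 1) ≤ r) :
    (P.IsCheckpoint t → (P.protocol A).turn (initialBits (P.stream s y r) t) = Turn.bob) ∧
    (¬ P.IsCheckpoint t → (P.protocol A).turn (initialBits (P.stream s y r) t) = Turn.alice) := by
  have : ¬ ∃ k, P.checkpoint k < (initialBits (P.stream s y r) t).length ∧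
      bitAt (initialBits (P.stream s y r) t) (P.checkpoint k) = true := by
    rintro ⟨k, hk, hb⟩
    rw [length_initialBits] at hk
    rw [bitAt_initialBits _ hk, stream_checkpoint] at hb
    exact absurd (h k hk) hb.not_ge
  constructor <;> intro ht <;> refine (if_neg this).trans ?_ <;> simp [ht]

/-- The hypothesis leaves out a checkpoint at position `t - 1`: the last bit may itself be the one
that stops the conversation, and the transcript still follows the stream. -/
lemma transcript_of_runs (t : ℕ)
    (h : ∀ k, P.checkpoint k + 1 < t → P.mass (P.code (chosen A x ω)) y (k + 1) ≤ ω.2) :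
    (P.protocol A).transcript x y ω t = initialBits (P.stream (chosen A x ω) y ω.2) t := by
  induction t with
  | zero => rfl
  | succ t ih =>
    have h' := fun k hk => h k (Nat.succ_lt_succ hk)
    rw [Protocol.transcript, ih fun k hk => h k (Nat.lt_succ_of_lt hk), initialBits_succ, Protocol.step]
    by_cases ht : P.IsCheckpoint t
    · rw [(P.turn_initialBits A y (chosen A x ω) ω.2 t h').1 ht]
      have : P.stream (chosen A x ω) y ω.2 t =
          decide (ω.2 < ∑ b, P.lower (P.code (chosen A x ω)) t y b) := if_pos ht
      rw [this]
      simp only [protocol, length_initialBits]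
      rw [P.lower_congr (e' := P.code (chosen A x ω))]
      intro i hi hc
      rw [bitAt_initialBits _ hi, P.stream_of_not _ _ _ hc]
    · rw [(P.turn_initialBits A y (chosen A x ω) ω.2 t h').2 ht, P.stream_of_not _ _ _ ht]
      simp only [protocol, length_initialBits, chosen]

lemma turn_stopped {k : ℕ} (hk : ω.2 < P.mass (P.code (chosen A x ω)) y (k + 1)) :
    (P.protocol A).turn (initialBits (P.stream (chosen A x ω) y ω.2) (P.checkpoint k + 1)) =
      Turn.halt := by
  have : ∃ j, P.checkpoint j < (initialBits (P.stream (chosen A x ω) y ω.2)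
        (P.checkpoint k + 1)).length ∧
      bitAt (initialBits (P.stream (chosen A x ω) y ω.2) (P.checkpoint k + 1))
        (P.checkpoint j) = true := by
    refine ⟨k, by simp, ?_⟩
    rw [bitAt_initialBits _ (Nat.lt_succ_self _), stream_checkpoint]
    exact hk
  simp only [protocol, this, if_true]

lemma transcript_stopped {k t : ℕ} (hr : P.Runs (chosen A x ω) y ω.2 k)
    (hk : ω.2 < P.mass (P.code (chosen A x ω)) y (k + 1)) (ht : P.checkpoint k < t) :
    (P.protocol A).transcript x y ω t =
      initialBits (P.stream (chosen A x ω) y ω.2) (P.checkpoint k + 1) := by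
  induction t, ht using Nat.le_induction with
  | base =>
    exact P.transcript_of_runs A x y ω _ fun j hj =>
      hr j (P.checkpoint_strictMono.lt_iff_lt.1 (Nat.lt_of_succ_lt_succ hj))
  | succ t _ ih =>
    rw [Protocol.transcript, ih, Protocol.step, P.turn_stopped A x y ω hk]

lemma exists_last_checkpoint {t : ℕ}
    (h : ¬ ∀ k, P.checkpoint k < t → P.mass (P.code (chosen A x ω)) y (k + 1) ≤ ω.2) :
    ∃ k, P.checkpoint k < t ∧ P.Runs (chosen A x ω) y ω.2 k ∧
      ω.2 < P.mass (P.code (chosen A x ω)) y (k + 1) := by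
  classical
  push Not at h
  refine ⟨Nat.find h, (Nat.find_spec h).1, fun j hj => ?_, (Nat.find_spec h).2⟩
  have := Nat.find_min h hj
  push Not at this
  exact this ((P.checkpoint_strictMono hj).trans (Nat.find_spec h).1)

lemma exists_checkpoint_of_halt {t : ℕ}
    (h : (P.protocol A).turn ((P.protocol A).transcript x y ω t) = Turn.halt) :
    ∃ k, P.checkpoint k < t ∧ P.Runs (chosen A x ω) y ω.2 k ∧
      ω.2 < P.mass (P.code (chosen A x ω)) y (k + 1) := by
  refine P.exists_last_checkpoint A x y ω fun hr => ?_
  rw [P.transcript_of_runs A x y ω t fun k hk => hr k (Nat.lt_of_succ_lt hk)] at h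
  by_cases ht : P.IsCheckpoint t
  · simp [(P.turn_initialBits A y _ _ t hr).1 ht] at h
  · simp [(P.turn_initialBits A y _ _ t hr).2 ht] at h

lemma bobOut_stopped (s : S) (r : ℝ) (k : ℕ) :
    (P.protocol A).bobOut y (initialBits (P.stream s y r) (P.checkpoint k + 1)) r =
      P.outcome (P.code s) y k r := by
  have hk : (P.checkpoint k + 1 - 1 - P.first) / (P.gap + 1) = k := by
    simp [checkpoint]
  have h : ∀ j ≤ k + 1, P.settled (bitAt (initialBits (P.stream s y r) (P.checkpoint k + 1))) y j =
      P.settled (P.code s) y j := fun j hj =>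
    P.settled_congr (k := k) (fun i hi hc => by
      rw [bitAt_initialBits _ (Nat.lt_succ_of_lt hi), P.stream_of_not _ _ _ hc]) y hj
  simp only [protocol, length_initialBits, hk, outcome, mass, h _ le_rfl, h _ k.le_succ]

/-- The random numbers for which Bob outputs `b` when Alice describes `s`. -/
def outcomeSet (s : S) (y : Y) (b : Fin (m y)) : Set ℝ :=
  {r | ∃ k, P.Runs s y r k ∧ r < P.mass (P.code s) y (k + 1) ∧ P.outcome (P.code s) y k r = b}

lemma outputs_iff (a : OA x) (b : Fin (m y)) :
    (P.protocol A).Outputs x y ω a b ↔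
      A.out x (A.choice x ω.1) = a ∧ ω.2 ∈ P.outcomeSet (chosen A x ω) y b := by
  constructor
  · rintro ⟨t, ht, ha, hb⟩
    obtain ⟨k, hkt, hr, hk⟩ := P.exists_checkpoint_of_halt A x y ω ht
    rw [P.transcript_stopped A x y ω hr hk hkt, P.bobOut_stopped] at hb
    exact ⟨ha, k, hr, hk, hb⟩
  · rintro ⟨ha, k, hr, hk, hb⟩
    refine ⟨P.checkpoint k + 1, ?_, ha, ?_⟩ <;>
      rw [P.transcript_stopped A x y ω hr hk (Nat.lt_succ_self _)]
    · exact P.turn_stopped A x y ω hk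
    · rw [P.bobOut_stopped, hb]

lemma ends_of_mem {b : Fin (m y)} (h : ω.2 ∈ P.outcomeSet (chosen A x ω) y b) :
    ∃ t, (P.protocol A).turn ((P.protocol A).transcript x y ω t) = Turn.halt := by
  obtain ⟨t, ht, -⟩ := (P.outputs_iff A x y ω _ b).2 ⟨rfl, h⟩
  exact ⟨t, ht⟩

lemma runs_of_alice {t : ℕ}
    (h : (P.protocol A).turn ((P.protocol A).transcript x y ω t) = Turn.alice) :
    ¬ P.IsCheckpoint t ∧
      ∀ k, P.checkpoint k < t → P.mass (P.code (chosen A x ω)) y (k + 1) ≤ ω.2 := by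
  have hr : ∀ k, P.checkpoint k < t → P.mass (P.code (chosen A x ω)) y (k + 1) ≤ ω.2 := by
    by_contra hr
    obtain ⟨k, hkt, hr, hk⟩ := P.exists_last_checkpoint A x y ω hr
    rw [P.transcript_stopped A x y ω hr hk hkt, P.turn_stopped A x y ω hk] at h
    cases h
  refine ⟨fun ht => ?_, hr⟩
  rw [P.transcript_of_runs A x y ω t fun k hk => hr k (Nat.lt_of_succ_lt hk),
    (P.turn_initialBits A y _ _ t hr).1 ht] at h
  cases h

lemma runs_of_bob {t : ℕ}
    (h : (P.protocol A).turn ((P.protocol A).transcript x y ω t) = Turn.bob) :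
    P.IsCheckpoint t ∧
      ∀ k, P.checkpoint k < t → P.mass (P.code (chosen A x ω)) y (k + 1) ≤ ω.2 := by
  have hr : ∀ k, P.checkpoint k < t → P.mass (P.code (chosen A x ω)) y (k + 1) ≤ ω.2 := by
    by_contra hr
    obtain ⟨k, hkt, hr, hk⟩ := P.exists_last_checkpoint A x y ω hr
    rw [P.transcript_stopped A x y ω hr hk hkt, P.turn_stopped A x y ω hk] at h
    cases h
  refine ⟨?_, hr⟩
  by_contra ht
  rw [P.transcript_of_runs A x y ω t fun k hk => hr k (Nat.lt_of_succ_lt hk),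
    (P.turn_initialBits A y _ _ t hr).2 ht] at h
  cases h

end transcript

end Scheme


namespace Scheme

variable {X S Y : Type} {m : Y → ℕ} {OA : X → Type} (P : Scheme S Y m)

/-! ### The law of the outputs -/

lemma measurableSet_outcomeSet (s : S) (y : Y) (b : Fin (m y)) :
    MeasurableSet (P.outcomeSet s y b) := by
  have : P.outcomeSet s y b = ⋃ k, (⋂ j, ⋂ _ : j < k, Set.Ici (P.mass (P.code s) y (j + 1))) ∩
      (Set.Iio (P.mass (P.code s) y (k + 1)) ∩ P.outcome (P.code s) y k ⁻¹' {b}) := by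
    ext r
    simp [outcomeSet, Runs]
  rw [this]
  refine MeasurableSet.iUnion fun k => MeasurableSet.inter ?_ (measurableSet_Iio.inter ?_)
  · exact MeasurableSet.iInter fun j => MeasurableSet.iInter fun _ => measurableSet_Ici
  · exact measurable_sample _ _ _ (measurableSet_singleton b)

lemma disjoint_outcomeSet (s : S) (y : Y) :
    Pairwise (Function.onFun Disjoint (P.outcomeSet s y)) := by
  intro b b' hb
  refine Set.disjoint_left.2 ?_
  rintro r ⟨k, hr, hk, rfl⟩ ⟨k', hr', hk', rfl⟩
  rcases lt_trichotomy k k' with h | h | h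
  · exact (hr' k h).not_gt hk
  · exact hb (by rw [h])
  · exact (hr k' h).not_gt hk'

/-- The slots of round `k` lie between two consecutive masses. A random number there has passed all
earlier checkpoints and stops at checkpoint `k`. -/
lemma slot_subset_outcomeSet (s : S) (y : Y) (k : ℕ) (b : Fin (m y)) :
    slot (P.mass (P.code s) y k)
      (fun b => P.settled (P.code s) y (k + 1) b - P.settled (P.code s) y k b) b ⊆
      P.outcomeSet s y b ∩ Set.Ico (P.mass (P.code s) y k) (P.mass (P.code s) y (k + 1)) := by
  have hw : ∀ b, 0 ≤ P.settled (P.code s) y (k + 1) b - P.settled (P.code s) y k b := fun b =>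
    sub_nonneg.2 (P.settled_le_succ s y k b)
  intro r hr
  have h := slot_subset _ hw b hr
  rw [Finset.sum_sub_distrib, ← mass, ← mass, add_sub_cancel] at h
  exact ⟨⟨k, fun j hj => (P.mass_mono s y hj).trans h.1, h.2, sample_eq _ hw hr⟩, h⟩

/-- The settled weight telescopes into increments, each realised by a slot in a new range of `r`. A
lower bound suffices because of `measure_eq_of_le`. -/
lemma settled_le_volume (s : S) (y : Y) (k : ℕ) (b : Fin (m y)) :
    ENNReal.ofReal (P.settled (P.code s) y k b) ≤
      volume (P.outcomeSet s y b ∩ Set.Ico 0 (P.mass (P.code s) y k)) := by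
  induction k with
  | zero => simp [settled]
  | succ k ih =>
    set w : Fin (m y) → ℝ := fun b =>
      P.settled (P.code s) y (k + 1) b - P.settled (P.code s) y k b with hw
    have hsub := P.slot_subset_outcomeSet s y k b
    have hmeas : MeasurableSet (slot (P.mass (P.code s) y k) w b) := measurableSet_Ico
    have hdisj : Disjoint (P.outcomeSet s y b ∩ Set.Ico 0 (P.mass (P.code s) y k))
        (slot (P.mass (P.code s) y k) w b) :=
      Set.disjoint_left.2 fun r hr hr' => hr.2.2.not_ge (hsub hr').2.1
    calc ENNReal.ofReal (P.settled (P.code s) y (k + 1) b)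
        = ENNReal.ofReal (P.settled (P.code s) y k b + w b) := by rw [hw]; congr 1; ring
      _ ≤ ENNReal.ofReal (P.settled (P.code s) y k b) + ENNReal.ofReal (w b) :=
          ENNReal.ofReal_add_le
      _ ≤ volume (P.outcomeSet s y b ∩ Set.Ico 0 (P.mass (P.code s) y k)) +
          volume (slot (P.mass (P.code s) y k) w b) := by rw [volume_slot]; gcongr
      _ = volume (P.outcomeSet s y b ∩ Set.Ico 0 (P.mass (P.code s) y k) ∪
          slot (P.mass (P.code s) y k) w b) := (measure_union hdisj hmeas).symm
      _ ≤ _ := by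
          refine measure_mono (Set.union_subset ?_ fun r hr => ?_)
          · exact Set.inter_subset_inter_right _
              (Set.Ico_subset_Ico_right (P.mass_mono s y k.le_succ))
          · exact ⟨(hsub hr).1, (P.mass_nonneg s y k).trans (hsub hr).2.1, (hsub hr).2.2⟩

/-- The probability that Bob does not stop up to checkpoint `k` is at most `c / 2 ^ k`. -/
def Converges (c : ℝ) : Prop := ∀ s y k, 1 - P.mass (P.code s) y (k + 1) ≤ c * (1 / 2) ^ k

variable {P}

lemma Converges.uniform_outcomeSet {c : ℝ} (hc : P.Converges c) (s : S) (y : Y) (b : Fin (m y)) :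
    uniform (P.outcomeSet s y b) = ENNReal.ofReal (P.law s y b) := by
  refine measure_eq_of_le (fun b => P.measurableSet_outcomeSet s y b)
    (P.disjoint_outcomeSet s y) (P.sum_law s y) (fun b => ?_) b
  have hset : ∀ k, P.settled (P.code s) y k b ≤ uniform.real (P.outcomeSet s y b) := by
    intro k
    refine (ENNReal.ofReal_le_iff_le_toReal (measure_ne_top _ _)).1
      ((P.settled_le_volume s y k b).trans ?_)
    rw [uniform, Measure.restrict_apply (P.measurableSet_outcomeSet s y b)]
    exact measure_mono (Set.inter_subset_inter_right _
      (Set.Ico_subset_Ico_right (P.mass_le_one s y k)))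
  have hlaw : ∀ k : ℕ, P.law s y b ≤ uniform.real (P.outcomeSet s y b) + c * (1 / 2) ^ k := by
    intro k
    have h1 : P.law s y b - P.settled (P.code s) y (k + 1) b ≤
        ∑ b, (P.law s y b - P.settled (P.code s) y (k + 1) b) :=
      Finset.single_le_sum (f := fun b => P.law s y b - P.settled (P.code s) y (k + 1) b)
        (fun b _ => sub_nonneg.2 (P.settled_le_law s y (k + 1) b)) (Finset.mem_univ b)
    rw [Finset.sum_sub_distrib, P.sum_law, ← mass] at h1
    linarith [hc s y k, hset (k + 1)]
  have hlim := ((tendsto_pow_atTop_nhds_zero_of_lt_one (r := (1 / 2 : ℝ)) (by norm_num)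
    (by norm_num)).const_mul c).const_add (uniform.real (P.outcomeSet s y b))
  rw [mul_zero, add_zero] at hlim
  exact ENNReal.ofReal_le_of_le_toReal (ge_of_tendsto' hlim hlaw)

instance : IsProbabilityMeasure privateRandomness :=
  inferInstanceAs (IsProbabilityMeasure (uniform.prod uniform))

lemma Converges.ae_ends {c : ℝ} (hc : P.Converges c) (A : LocalChoice X S OA) (x : X) (y : Y) :
    ∀ᵐ ω ∂privateRandomness,
      ∃ t, (P.protocol A).turn ((P.protocol A).transcript x y ω t) = Turn.halt := by
  have h : ∀ s, ∀ᵐ r ∂uniform, r ∈ ⋃ b, P.outcomeSet s y b := by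
    intro s
    refine (mem_ae_iff_prob_eq_one
      (MeasurableSet.iUnion fun b => P.measurableSet_outcomeSet s y b)).2 ?_
    rw [measure_iUnion (P.disjoint_outcomeSet s y) (fun b => P.measurableSet_outcomeSet s y b),
      tsum_fintype]
    simp_rw [hc.uniform_outcomeSet]
    rw [← ENNReal.ofReal_sum_of_nonneg fun b _ => P.law_nonneg s y b, P.sum_law,
      ENNReal.ofReal_one]
  -- Alice has finitely many choices, so one null set of Bob's random numbers serves for all of
  -- them.
  have h' : ∀ᵐ r ∂uniform, ∀ j : Fin (A.size x), r ∈ ⋃ b, P.outcomeSet (A.state x j) y b :=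
    ae_all_iff.2 fun j => h _
  filter_upwards [(Measure.quasiMeasurePreserving_snd (μ := uniform) (ν := uniform)).ae h']
    with ω hω
  obtain ⟨b, hb⟩ := Set.mem_iUnion.1 (hω (A.choice x ω.1))
  exact P.ends_of_mem A x y ω hb

lemma Converges.prob_outputs {c : ℝ} (hc : P.Converges c) (A : LocalChoice X S OA) (x : X) (y : Y)
    [DecidableEq (OA x)] (a : OA x) (b : Fin (m y)) :
    privateRandomness.real {ω | (P.protocol A).Outputs x y ω a b} =
      ∑ j with A.out x j = a,
        uniform.real {r | A.choice x r = j} * P.law (A.state x j) y b := by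
  have hset : {ω | (P.protocol A).Outputs x y ω a b} =
      ⋃ j ∈ Finset.univ.filter (fun j => A.out x j = a),
        {r | A.choice x r = j} ×ˢ P.outcomeSet (A.state x j) y b := by
    ext ω
    simp only [Set.mem_ofPred_eq, P.outputs_iff, Finset.mem_filter, Finset.mem_univ, true_and,
      Set.mem_iUnion, Set.mem_prod, exists_prop]
    constructor
    · rintro ⟨ha, hb⟩
      exact ⟨_, ha, rfl, hb⟩
    · rintro ⟨j, ha, rfl, hb⟩
      exact ⟨ha, hb⟩
  have hmeas : ∀ j, MeasurableSet {r | A.choice x r = j} := fun j =>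
    A.measurable_choice x (measurableSet_singleton j)
  rw [hset, measureReal_biUnion_finset]
  · refine Finset.sum_congr rfl fun j _ => ?_
    rw [privateRandomness, measureReal_prod_prod]
    congr 1
    rw [measureReal_def, hc.uniform_outcomeSet, ENNReal.toReal_ofReal (P.law_nonneg _ _ _)]
  · intro i _ j _ hij
    refine Set.disjoint_left.2 fun ω hi hj => hij ?_
    exact Eq.trans (Eq.symm hi.1) hj.1
  · exact fun j _ => (hmeas j).prod (P.measurableSet_outcomeSet _ _ _)

/-! ### The average number of bits -/

lemma tsum_eq_sum_add_tsum_blocks (f : ℕ → ℝ≥0∞) (M p : ℕ) [NeZero p] :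
    ∑' t, f t = ∑ t ∈ Finset.range M, f t +
      ∑' q, ∑ i ∈ Finset.range p, f (M + q * p + i) := by
  have h : ∑' t, f t = ∑ t ∈ Finset.range M, f t + ∑' i, f (i + M) :=
    (ENNReal.summable.sum_add_tsum_nat_add' (f := f) (k := M)).symm
  rw [h, ← (Nat.divModEquiv p).symm.tsum_eq (fun i => f (i + M)), ENNReal.tsum_prod']
  congr 2
  funext q
  rw [tsum_fintype, ← Fin.sum_univ_eq_sum_range (fun i => f (M + q * p + i))]
  refine Finset.sum_congr rfl fun i _ => ?_
  congr 1
  simp [Nat.divModEquiv]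
  ring

variable (P)

open Classical in
/-- The indicator that Bob does not stop at checkpoint `k`. -/
noncomputable def goesOn (s : S) (y : Y) (r : ℝ) (k : ℕ) : ℝ≥0∞ :=
  if P.mass (P.code s) y (k + 1) ≤ r then 1 else 0

lemma aliceBits_le (A : LocalChoice X S OA) (x : X) (y : Y) (ω : ℝ × ℝ) :
    (P.protocol A).aliceBits x y ω ≤
      P.first + P.gap * ∑' k, P.goesOn (chosen A x ω) y ω.2 k := by
  classical
  rw [Protocol.aliceBits, tsum_eq_sum_add_tsum_blocks _ P.first (P.gap + 1),
    ← ENNReal.tsum_mul_left]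
  refine add_le_add ?_ (ENNReal.tsum_le_tsum fun q => ?_)
  · refine (Finset.sum_le_card_nsmul _ _ 1 fun t _ => ?_).trans (by simp)
    split_ifs <;> simp
  -- Block `q` opens with Bob's bit; its remaining `P.gap` bits are sent only if Bob goes on at
  -- checkpoint `q`.
  · rw [Finset.sum_range_succ', if_neg, add_zero]
    · refine (Finset.sum_le_card_nsmul _ _ (P.goesOn (chosen A x ω) y ω.2 q) fun i _ => ?_).trans
        (by simp)
      split_ifs with h
      · have := (P.runs_of_alice A x y ω h).2 q (by simp only [checkpoint]; omega)
        rw [goesOn, if_pos this]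
      · exact zero_le
    · intro h
      exact (P.runs_of_alice A x y ω h).1 ⟨q, rfl⟩

lemma bobBits_le (A : LocalChoice X S OA) (x : X) (y : Y) (ω : ℝ × ℝ) :
    (P.protocol A).bobBits x y ω ≤ 1 + ∑' k, P.goesOn (chosen A x ω) y ω.2 k := by
  classical
  rw [Protocol.bobBits, tsum_eq_sum_add_tsum_blocks _ P.first (P.gap + 1)]
  rw [Finset.sum_eq_zero, zero_add, tsum_eq_zero_add' ENNReal.summable]
  · have hblock : ∀ q, (∑ i ∈ Finset.range (P.gap + 1),
        if (P.protocol A).turn ((P.protocol A).transcript x y ω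
          (P.first + q * (P.gap + 1) + i)) = Turn.bob then (1 : ℝ≥0∞) else 0) ≤
        if ∀ k < q, P.mass (P.code (chosen A x ω)) y (k + 1) ≤ ω.2 then 1 else 0 := by
      intro q
      rw [Finset.sum_range_succ', Finset.sum_eq_zero, zero_add]
      · split_ifs with h1 h2
        · exact le_rfl
        · exact absurd (fun k hk => (P.runs_of_bob A x y ω h1).2 k
            (P.checkpoint_strictMono hk)) h2
        all_goals exact zero_le
      · intro i hi
        rw [if_neg]
        intro h
        obtain ⟨k, hk⟩ := (P.runs_of_bob A x y ω h).1
        have hi := Finset.mem_range.1 hi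
        have h1 : P.checkpoint q < P.checkpoint k := by
          rw [← hk]; simp only [checkpoint]; omega
        have h2 : P.checkpoint k < P.checkpoint (q + 1) := by
          rw [← hk]; simp only [checkpoint, add_mul]; omega
        have := P.checkpoint_strictMono.lt_iff_lt.1 h1
        have := P.checkpoint_strictMono.lt_iff_lt.1 h2
        omega
    -- Bob's first bit is charged to the constant 1, and the bit of block `q + 1` to his going on at
    -- checkpoint `q`.
    refine add_le_add ((hblock 0).trans (by simp))
      (ENNReal.tsum_le_tsum fun q => (hblock (q + 1)).trans ?_)
    rw [goesOn]
    split_ifs with h1 h2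
    · exact le_rfl
    · exact absurd (h1 q q.lt_succ_self) h2
    all_goals exact zero_le
  · intro t ht
    rw [if_neg]
    intro h
    obtain ⟨k, hk⟩ := (P.runs_of_bob A x y ω h).1
    have := Finset.mem_range.1 ht
    simp only [checkpoint] at hk
    omega

lemma measurable_goesOn (s : S) (y : Y) (k : ℕ) : Measurable fun r => P.goesOn s y r k :=
  Measurable.ite measurableSet_Ici measurable_const measurable_const

variable {P}

lemma Converges.lintegral_goesOn {c : ℝ} (hc : P.Converges c) (s : S) (y : Y) (k : ℕ) :
    ∫⁻ r, P.goesOn s y r k ∂uniform ≤ ENNReal.ofReal (c * (1 / 2) ^ k) := by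
  have : (fun r => P.goesOn s y r k) =
      (Set.Ici (P.mass (P.code s) y (k + 1))).indicator 1 := by
    funext r
    simp [goesOn, Set.indicator_apply]
  rw [this, lintegral_indicator_one measurableSet_Ici, uniform,
    Measure.restrict_apply measurableSet_Ici]
  calc volume (Set.Ici (P.mass (P.code s) y (k + 1)) ∩ Set.Ico 0 1)
      ≤ volume (Set.Ico (P.mass (P.code s) y (k + 1)) 1) :=
        measure_mono fun r hr => ⟨hr.1, hr.2.2⟩
    _ ≤ _ := by
        rw [Real.volume_Ico]
        exact ENNReal.ofReal_le_ofReal (hc s y k)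

lemma Converges.lintegral_le {c : ℝ} (hc : P.Converges c) (hc0 : 0 ≤ c) (A : LocalChoice X S OA)
    (x : X) (y : Y) (u v : ℝ≥0∞) :
    ∫⁻ ω, (u + v * ∑' k, P.goesOn (chosen A x ω) y ω.2 k) ∂privateRandomness ≤
      u + v * ENNReal.ofReal (2 * c) := by
  have hsum : ∑' k : ℕ, ENNReal.ofReal (c * (1 / 2) ^ k) = ENNReal.ofReal (2 * c) := by
    rw [← ENNReal.ofReal_tsum_of_nonneg (fun k => by positivity)
      (summable_geometric_two.mul_left c), tsum_mul_left, tsum_geometric_two, mul_comm]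
  have hinner : ∀ s, ∫⁻ r, (u + v * ∑' k, P.goesOn s y r k) ∂uniform ≤
      u + v * ENNReal.ofReal (2 * c) := by
    intro s
    have hm : Measurable fun r => ∑' k, P.goesOn s y r k :=
      Measurable.tsum fun k => P.measurable_goesOn s y k
    rw [lintegral_add_left measurable_const, lintegral_const_mul _ hm,
      lintegral_tsum fun k => (P.measurable_goesOn s y k).aemeasurable, lintegral_const,
      measure_univ, mul_one, ← hsum]
    exact add_le_add le_rfl (mul_le_mul_right
      (ENNReal.tsum_le_tsum fun k => hc.lintegral_goesOn s y k) v)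
  calc ∫⁻ ω, (u + v * ∑' k, P.goesOn (chosen A x ω) y ω.2 k) ∂privateRandomness
      ≤ ∫⁻ r₁, ∫⁻ r₂, (u + v * ∑' k, P.goesOn (A.state x (A.choice x r₁)) y r₂ k) ∂uniform
          ∂uniform := lintegral_prod_le (μ := uniform) (ν := uniform)
            fun ω => u + v * ∑' k, P.goesOn (chosen A x ω) y ω.2 k
    _ ≤ ∫⁻ _, (u + v * ENNReal.ofReal (2 * c)) ∂uniform := lintegral_mono fun r => hinner _
    _ = u + v * ENNReal.ofReal (2 * c) := by rw [lintegral_const, measure_univ, mul_one]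

lemma Converges.avgAliceBits_le {c : ℝ} (hc : P.Converges c) (hc0 : 0 ≤ c)
    (A : LocalChoice X S OA) (x : X) (y : Y) :
    (P.protocol A).avgAliceBits x y ≤ P.first + P.gap * ENNReal.ofReal (2 * c) :=
  (lintegral_mono fun ω => P.aliceBits_le A x y ω).trans (hc.lintegral_le hc0 A x y _ _)

lemma Converges.avgBobBits_le {c : ℝ} (hc : P.Converges c) (hc0 : 0 ≤ c)
    (A : LocalChoice X S OA) (x : X) (y : Y) :
    (P.protocol A).avgBobBits x y ≤ 1 + ENNReal.ofReal (2 * c) := by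
  refine (lintegral_mono fun ω => P.bobBits_le A x y ω).trans ?_
  simpa using hc.lintegral_le hc0 A x y 1 1

lemma Converges.avgBits_le {c : ℝ} (hc : P.Converges c) (hc0 : 0 ≤ c)
    (A : LocalChoice X S OA) (x : X) (y : Y) :
    (P.protocol A).avgBits x y ≤
      (P.first + P.gap * ENNReal.ofReal (2 * c)) + (1 + ENNReal.ofReal (2 * c)) := by
  refine (lintegral_mono fun ω => ?_).trans
    ((hc.lintegral_le hc0 A x y (P.first + 1) (P.gap + 1)).trans (le_of_eq (by ring)))
  exact (add_le_add (P.aliceBits_le A x y ω) (P.bobBits_le A x y ω)).trans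
    (le_of_eq (by ring))

end Scheme


/-! ### Born probabilities -/

section born

variable {ι : Type} [Fintype ι]

open scoped MatrixOrder Matrix.Norms.L2Operator in
lemma exists_eq_conjTranspose_mul_self [DecidableEq ι] {B : Matrix ι ι ℂ} (hB : B.PosSemidef) :
    ∃ C : Matrix ι ι ℂ, B = C.conjTranspose * C :=
  CStarAlgebra.nonneg_iff_eq_star_mul_self.1 hB.nonneg

/-- Factoring an effect as a Gram matrix reduces estimates of Born probabilities to scalar
estimates, one for each row. -/
lemma born_gram (v : ι → ℂ) (C : Matrix ι ι ℂ) :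
    born v (C.conjTranspose * C) = ∑ i, ‖C.mulVec v i‖ ^ 2 := by
  rw [born, ← Matrix.mulVec_mulVec, Matrix.dotProduct_mulVec, Matrix.vecMul_conjTranspose,
    star_star, dotProduct, Complex.re_sum]
  refine Finset.sum_congr rfl fun i _ => ?_
  rw [Pi.star_apply, ← Complex.normSq_eq_norm_sq]
  simp [Complex.normSq_apply]

lemma trace_gram (C : Matrix ι ι ℂ) :
    (C.conjTranspose * C).trace.re = ∑ i, ∑ j, ‖C i j‖ ^ 2 := by
  rw [Matrix.trace, Complex.re_sum, Finset.sum_comm]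
  refine Finset.sum_congr rfl fun i _ => ?_
  rw [Matrix.diag_apply, Matrix.mul_apply, Complex.re_sum]
  refine Finset.sum_congr rfl fun j _ => ?_
  rw [← Complex.normSq_eq_norm_sq]
  simp [Complex.normSq_apply]

lemma born_nonneg [DecidableEq ι] (v : ι → ℂ) {B : Matrix ι ι ℂ} (hB : B.PosSemidef) :
    0 ≤ born v B := by
  obtain ⟨C, rfl⟩ := exists_eq_conjTranspose_mul_self hB
  rw [born_gram]
  positivity

lemma born_sum {κ : Type*} (s : Finset κ) (v : ι → ℂ) (B : κ → Matrix ι ι ℂ) :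
    ∑ l ∈ s, born v (B l) = born v (∑ l ∈ s, B l) := by
  simp only [born, Matrix.sum_mulVec, dotProduct_sum, Complex.re_sum]

lemma born_one [DecidableEq ι] (v : ι → ℂ) : born v 1 = ∑ i, ‖v i‖ ^ 2 := by
  have := born_gram v (1 : Matrix ι ι ℂ)
  simpa using this

lemma born_smul (c : ℂ) (v : ι → ℂ) (B : Matrix ι ι ℂ) :
    born (c • v) B = ‖c‖ ^ 2 * born v B := by
  rw [born, born, star_smul, Matrix.mulVec_smul, smul_dotProduct, dotProduct_smul, smul_smul,
    smul_eq_mul, Complex.star_def, Complex.conj_mul', ← Complex.ofReal_pow, Complex.re_ofReal_mul]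

/-- Cauchy–Schwarz in each row of a Gram factor. The trace, unlike the operator norm, has a sum over
the POVM that is independent of the number of outcomes. -/
lemma born_le_trace_mul [DecidableEq ι] (v : ι → ℂ) {B : Matrix ι ι ℂ} (hB : B.PosSemidef) :
    born v B ≤ B.trace.re * ∑ i, ‖v i‖ ^ 2 := by
  obtain ⟨C, rfl⟩ := exists_eq_conjTranspose_mul_self hB
  rw [born_gram, trace_gram, Finset.sum_mul]
  refine Finset.sum_le_sum fun i _ => ?_
  refine le_trans ?_ (Finset.sum_mul_sq_le_sq_mul_sq Finset.univ (fun j => ‖C i j‖) fun j => ‖v j‖)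
  gcongr
  refine (norm_sum_le _ _).trans (le_of_eq ?_)
  simp

/-- The triangle inequality gives `‖b‖ ^ 2 - 2 * ‖b‖ * ‖a - b‖ ≤ ‖a‖ ^ 2`; a weighted AM–GM
inequality absorbs the cross term. -/
lemma norm_sq_ge (a b : ℂ) {t : ℝ} (ht : 0 < t) :
    (1 - t) * ‖b‖ ^ 2 - t⁻¹ * ‖a - b‖ ^ 2 ≤ ‖a‖ ^ 2 := by
  have h1 : ‖b‖ ≤ ‖a‖ + ‖a - b‖ := by
    have := norm_sub_norm_le b a
    rw [norm_sub_rev] at this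
    linarith
  have h2 : t * t⁻¹ = 1 := mul_inv_cancel₀ ht.ne'
  have h3 : 0 < t⁻¹ := inv_pos.2 ht
  have h4 : 2 * (‖b‖ * ‖a - b‖) ≤ t * ‖b‖ ^ 2 + t⁻¹ * ‖a - b‖ ^ 2 := by
    have : 0 ≤ t⁻¹ * (t * ‖b‖ - ‖a - b‖) ^ 2 := by positivity
    have e : t⁻¹ * (t * ‖b‖ - ‖a - b‖) ^ 2 = (t * t⁻¹) * t * ‖b‖ ^ 2
      - 2 * (t * t⁻¹) * (‖b‖ * ‖a - b‖) + t⁻¹ * ‖a - b‖ ^ 2 := by ring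
    rw [e, h2] at this
    linarith
  have h5 : ‖b‖ ^ 2 - 2 * (‖b‖ * ‖a - b‖) ≤ ‖a‖ ^ 2 := by
    rcases le_total ‖b‖ ‖a - b‖ with h | h
    · nlinarith [norm_nonneg b, norm_nonneg a]
    · nlinarith [norm_nonneg b, norm_nonneg a, norm_nonneg (a - b)]
  linarith

/-- Nearby vectors have nearby Born probabilities. -/
lemma le_born [DecidableEq ι] (v w : ι → ℂ) {B : Matrix ι ι ℂ} (hB : B.PosSemidef) {t : ℝ}
    (ht : 0 < t) :
    (1 - t) * born w B - t⁻¹ * (B.trace.re * ∑ i, ‖v i - w i‖ ^ 2) ≤ born v B := by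
  have h := mul_le_mul_of_nonneg_left (born_le_trace_mul (v - w) hB) (inv_pos.2 ht).le
  simp only [Pi.sub_apply] at h
  refine le_trans (sub_le_sub_left h _) ?_
  obtain ⟨C, rfl⟩ := exists_eq_conjTranspose_mul_self hB
  simp only [born_gram, Finset.mul_sum, ← Finset.sum_sub_distrib]
  refine Finset.sum_le_sum fun i _ => ?_
  rw [Matrix.mulVec_sub]
  exact norm_sq_ge _ _ ht

end born

/-! ### Binary expansions -/

/-- What remains of `x` after `k` digits of its expansion with digits `1` and `-1`. -/
noncomputable def remainder (x : ℝ) : ℕ → ℝ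
  | 0 => x
  | k + 1 => 2 * remainder x k - if 0 ≤ remainder x k then 1 else -1

/-- The digits of `x ∈ [-1, 1]` in the expansion with digits `1` and `-1`. -/
noncomputable def digit (x : ℝ) (k : ℕ) : Bool := decide (0 ≤ remainder x k)

lemma abs_remainder_le {x : ℝ} (hx : |x| ≤ 1) (k : ℕ) : |remainder x k| ≤ 1 := by
  induction k with
  | zero => exact hx
  | succ k ih =>
    rw [abs_le] at ih ⊢
    rw [remainder]
    split_ifs <;> constructor <;> linarith

/-- Equal digits subtract equal amounts, so each step only doubles the difference. -/
lemma remainder_sub {x y : ℝ} {k : ℕ} (h : ∀ j < k, digit x j = digit y j) :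
    remainder x k - remainder y k = 2 ^ k * (x - y) := by
  induction k with
  | zero => simp [remainder]
  | succ k ih =>
    have h1 := ih fun j hj => h j (Nat.lt_succ_of_lt hj)
    have h2 : (0 ≤ remainder x k) ↔ (0 ≤ remainder y k) := by
      simpa [digit] using h k k.lt_succ_self
    rw [remainder, remainder, pow_succ]
    simp only [h2]
    linarith

lemma sq_sub_le_of_digit {x y : ℝ} (hx : |x| ≤ 1) (hy : |y| ≤ 1) {k : ℕ}
    (h : ∀ j < k, digit x j = digit y j) : (x - y) ^ 2 ≤ 4 * (1 / 4) ^ k := by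
  have h1 := remainder_sub h
  have h2 : (remainder x k - remainder y k) ^ 2 ≤ 4 := by
    have hx := abs_le.1 (abs_remainder_le hx k)
    have hy := abs_le.1 (abs_remainder_le hy k)
    nlinarith
  rw [h1, mul_pow, ← pow_mul, mul_comm k, pow_mul] at h2
  norm_num at h2
  rw [one_div, inv_pow, ← div_eq_mul_inv, le_div_iff₀ (by positivity)]
  linarith

/-! ### The description of a quantum state -/

section description

variable {n : ℕ}

/-- The state with its global phase changed so that the amplitude at `0` is real. -/
noncomputable def fixPhase (ψ : PureState (Qubits n)) : Qubits n → ℂ :=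
  (if ψ.1 0 = 0 then (1 : ℂ) else star (ψ.1 0) / ‖ψ.1 0‖) • (ψ.1 : Qubits n → ℂ)

lemma norm_phase (z : ℂ) : ‖if z = 0 then (1 : ℂ) else star z / ‖z‖‖ = 1 := by
  split_ifs with h
  · simp
  · simp [h]

lemma born_fixPhase (ψ : PureState (Qubits n)) (B : Matrix (Qubits n) (Qubits n) ℂ) :
    born (fixPhase ψ) B = born ψ.1 B := by
  rw [fixPhase, born_smul, norm_phase, one_pow, one_mul]

lemma fixPhase_zero_im (ψ : PureState (Qubits n)) : (fixPhase ψ 0).im = 0 := by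
  rw [fixPhase, Pi.smul_apply, smul_eq_mul]
  split_ifs with h
  · simp [h]
  · rw [div_mul_eq_mul_div, Complex.star_def, Complex.conj_mul', ← Complex.ofReal_pow,
      ← Complex.ofReal_div, Complex.ofReal_im]

lemma sum_norm_sq (ψ : PureState (Qubits n)) : ∑ q, ‖ψ.1 q‖ ^ 2 = 1 := by
  rw [← EuclideanSpace.norm_sq_eq, ψ.2, one_pow]

lemma norm_fixPhase_le (ψ : PureState (Qubits n)) (q : Qubits n) : ‖fixPhase ψ q‖ ≤ 1 := by
  rw [fixPhase, Pi.smul_apply, smul_eq_mul, norm_mul, norm_phase, one_mul]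
  exact (PiLp.norm_apply_le ψ.1 q).trans ψ.2.le

/-- The real coordinates of a state that has a real amplitude at `0`; `true` stands for
imaginary parts. -/
abbrev RealCoord (n : ℕ) : Type := {p : Qubits n × Bool // p ≠ (0, true)}

/-- The number of real coordinates. -/
def coordCount (n : ℕ) : ℕ := Fintype.card (RealCoord n)

lemma coordCount_add_one (n : ℕ) : coordCount n + 1 = 2 * 2 ^ n := by
  have : coordCount n = 2 ^ n * 2 - 1 := by
    rw [coordCount, Fintype.card_subtype_compl]
    simp
  have := Nat.one_le_two_pow (n := n)
  omega

/-- The value of a real coordinate. -/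
noncomputable def realCoord (ψ : PureState (Qubits n)) (p : Qubits n × Bool) : ℝ :=
  if p.2 then (fixPhase ψ p.1).im else (fixPhase ψ p.1).re

lemma abs_realCoord_le (ψ : PureState (Qubits n)) (p : Qubits n × Bool) :
    |realCoord ψ p| ≤ 1 := by
  refine le_trans ?_ (norm_fixPhase_le ψ p.1)
  unfold realCoord
  split_ifs
  · exact Complex.abs_im_le_norm _
  · exact Complex.abs_re_le_norm _

/-- The real coordinates, numbered. -/
noncomputable def coord (ψ : PureState (Qubits n)) (j : ℕ) : ℝ :=
  if h : j < coordCount n then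
    realCoord ψ ((Fintype.equivFin (RealCoord n)).symm ⟨j, h⟩).1 else 0

lemma coord_equivFin (ψ : PureState (Qubits n)) (p : RealCoord n) :
    coord ψ (Fintype.equivFin (RealCoord n) p) = realCoord ψ p.1 := by
  unfold coord
  rw [dif_pos (show _ < coordCount n from (Fintype.equivFin (RealCoord n) p).2)]
  simp

/-- The squared distance is a sum over real coordinates; the omitted one vanishes for both states
after the phase is fixed. -/
lemma sum_norm_sub_sq_le {φ ψ : PureState (Qubits n)} {k : ℕ}
    (h : ∀ j < coordCount n, ∀ i < k, digit (coord φ j) i = digit (coord ψ j) i) :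
    ∑ q, ‖fixPhase φ q - fixPhase ψ q‖ ^ 2 ≤ coordCount n * (4 * (1 / 4) ^ k) := by
  have h1 : ∑ q, ‖fixPhase φ q - fixPhase ψ q‖ ^ 2 =
      ∑ p : Qubits n × Bool, (realCoord φ p - realCoord ψ p) ^ 2 := by
    rw [Fintype.sum_prod_type]
    refine Finset.sum_congr rfl fun q _ => ?_
    rw [← Complex.normSq_eq_norm_sq]
    simp [realCoord, Complex.normSq_apply]
    ring
  have h2 : ∑ p : Qubits n × Bool, (realCoord φ p - realCoord ψ p) ^ 2 =
      ∑ p : RealCoord n, (realCoord φ p.1 - realCoord ψ p.1) ^ 2 := by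
    rw [← Finset.sum_subtype (Finset.univ.erase ((0, true) : Qubits n × Bool)) (by simp)
      fun p => (realCoord φ p - realCoord ψ p) ^ 2]
    refine (Finset.sum_erase _ ?_).symm
    simp [realCoord, fixPhase_zero_im]
  rw [h1, h2]
  refine (Finset.sum_le_card_nsmul _ _ (4 * (1 / 4) ^ k) fun p _ => ?_).trans ?_
  · refine sq_sub_le_of_digit (abs_realCoord_le _ _) (abs_realCoord_le _ _) fun i hi => ?_
    rw [← coord_equivFin, ← coord_equivFin]
    exact h _ (Fintype.equivFin (RealCoord n) p).2 i hi
  · simp [coordCount]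

/-- The description of a state: first `n + 4` digits of each real coordinate, and then one more
digit of each coordinate after each bit sent by Bob. -/
noncomputable def describe (ψ : PureState (Qubits n)) (i : ℕ) : Bool :=
  if i < coordCount n * (n + 4) then digit (coord ψ (i % coordCount n)) (i / coordCount n)
  -- Offset 0 in a block is Bob's position, so coordinate `j` has offset `j + 1`. The truncated
  -- value `0 - 1 = 0` at offset 0 is never used.
  else digit (coord ψ ((i - coordCount n * (n + 4)) % (coordCount n + 1) - 1))
    (n + 4 + (i - coordCount n * (n + 4)) / (coordCount n + 1))

lemma POVM.outcomes_pos (N : POVM (Qubits n)) : 0 < N.outcomes := by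
  refine Nat.pos_of_ne_zero fun h => ?_
  have h1 := N.sum_effect
  have : IsEmpty (Fin N.outcomes) := by rw [h]; infer_instance
  rw [Finset.univ_eq_empty, Finset.sum_empty] at h1
  exact zero_ne_one h1

lemma POVM.sum_trace (N : POVM (Qubits n)) : ∑ l, (N.effect l).trace.re = 2 ^ n := by
  rw [← Complex.re_sum, ← Matrix.trace_sum, N.sum_effect, Matrix.trace_one,
    Complex.natCast_re]
  simp

/-- Classical teleportation of pure states. -/
noncomputable def teleportation (n : ℕ) :
    Scheme (PureState (Qubits n)) (POVM (Qubits n)) POVM.outcomes where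
  code := describe
  law ψ N l := born ψ.1 (N.effect l)
  law_nonneg ψ N l := born_nonneg _ (N.posSemidef l)
  sum_law ψ N := by rw [born_sum, N.sum_effect, born_one, sum_norm_sq]
  pos := POVM.outcomes_pos
  first := coordCount n * (n + 4)
  gap := coordCount n

/-- Each required digit has an explicit position before checkpoint `k`: `j + coordCount n * i` in
the initial part, or offset `j + 1` in a later block. Such offsets are nonzero modulo `coordCount n
+ 1`, so no checkpoint is hit. -/
lemma digit_eq_of_describe_eq {φ ψ : PureState (Qubits n)} {k : ℕ}
    (h : ∀ i < (teleportation n).checkpoint k, ¬ (teleportation n).IsCheckpoint i →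
      describe φ i = describe ψ i) {j : ℕ} (hj : j < coordCount n) {i : ℕ} (hi : i < n + 4 + k) :
    digit (coord φ j) i = digit (coord ψ j) i := by
  have hc : ∀ k, (teleportation n).checkpoint k =
      coordCount n * (n + 4) + k * (coordCount n + 1) := fun _ => rfl
  rcases lt_or_ge i (n + 4) with h4 | h4
  · have hlt : j + coordCount n * i < coordCount n * (n + 4) := by
      calc j + coordCount n * i < coordCount n + coordCount n * i := by omega
        _ = coordCount n * (i + 1) := by ring
        _ ≤ _ := Nat.mul_le_mul_left _ h4
    have := h (j + coordCount n * i) (by rw [hc]; omega) (by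
      rintro ⟨k', hk'⟩
      rw [hc] at hk'
      omega)
    simp only [describe, if_pos hlt, Nat.add_mul_mod_self_left, Nat.mod_eq_of_lt hj,
      Nat.add_mul_div_left _ _ (Nat.zero_lt_of_lt hj), Nat.div_eq_of_lt hj, zero_add] at this
    exact this
  · obtain ⟨q, rfl⟩ := Nat.exists_eq_add_of_le h4
    have hq : q + 1 ≤ k := by omega
    have hmod : (j + 1 + (coordCount n + 1) * q) % (coordCount n + 1) = j + 1 := by
      rw [Nat.add_mul_mod_self_left, Nat.mod_eq_of_lt (by omega)]
    have hdiv : (j + 1 + (coordCount n + 1) * q) / (coordCount n + 1) = q := by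
      rw [Nat.add_mul_div_left _ _ (Nat.succ_pos _), Nat.div_eq_of_lt (by omega), zero_add]
    have := h (coordCount n * (n + 4) + (j + 1 + (coordCount n + 1) * q)) (by
      rw [hc]
      have := Nat.mul_le_mul_right (coordCount n + 1) hq
      rw [add_mul, one_mul, mul_comm q] at this
      omega) (by
      rintro ⟨k', hk'⟩
      rw [hc, Nat.add_left_cancel_iff] at hk'
      rw [hk', Nat.mul_mod_left] at hmod
      omega)
    simpa only [describe, if_neg (Nat.not_lt.2 (Nat.le_add_right _ _)), Nat.add_sub_cancel_left,
      hmod, hdiv, Nat.add_sub_cancel] using this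

/-- With `h = 2 ^ (-k)`, summing `le_born` over the outcomes bounds the missing mass by `t + t⁻¹ * 2
^ n * D`, where `2 ^ n * D ≤ h ^ 2 / 32`. The choice `t = 3 / 16 * h`, close to the optimum `h /
√32`, gives `(3 / 16 + 1 / 6) * h`, which is below `3 / 8 * h`. -/
lemma converges_teleportation (n : ℕ) : (teleportation n).Converges (3 / 8) := by
  intro ψ N k
  set h : ℝ := (1 / 2) ^ k with hh
  have hpos : 0 < h := by positivity
  set D : ℝ := coordCount n * (4 * (1 / 4) ^ (n + 4 + k)) with hD
  have hD' : 2 ^ n * D ≤ h ^ 2 / 32 := by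
    have h1 : (coordCount n : ℝ) + 1 = 2 * 2 ^ n := by exact_mod_cast coordCount_add_one n
    have h2 : (1 / 4 : ℝ) ^ (n + 4 + k) = (1 / 2 ^ n) ^ 2 * (1 / 256) * h ^ 2 := by
      rw [hh, ← one_div_pow, ← pow_mul, ← pow_mul, mul_comm n, mul_comm k, pow_mul, pow_mul]
      norm_num [pow_add]
    have h3 : (0 : ℝ) < 2 ^ n := by positivity
    calc (2 : ℝ) ^ n * D ≤ 2 ^ n * (2 * 2 ^ n * (4 * (1 / 4) ^ (n + 4 + k))) := by
          rw [hD]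
          gcongr
          linarith
      _ = h ^ 2 / 32 := by
          rw [h2]
          field_simp
          norm_num
  have hlow : ∀ l, (1 - 3 / 16 * h) * born ψ.1 (N.effect l) -
      (3 / 16 * h)⁻¹ * ((N.effect l).trace.re * D) ≤
      (teleportation n).settled ((teleportation n).code ψ) N (k + 1) l := by
    intro l
    refine (teleportation n).le_lower ψ _ N l fun φ hφ => ?_
    have h1 := sum_norm_sub_sq_le fun j hj i hi => digit_eq_of_describe_eq hφ hj hi
    have h2 := le_born (fixPhase φ) (fixPhase ψ) (N.posSemidef l) (t := 3 / 16 * h) (by positivity)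
    rw [born_fixPhase, born_fixPhase] at h2
    refine le_trans ?_ h2
    have htr : 0 ≤ (N.effect l).trace.re := (Complex.le_def.1 (N.posSemidef l).trace_nonneg).1
    gcongr
  have hsum := Finset.sum_le_sum fun l (_ : l ∈ Finset.univ) => hlow l
  have hborn : ∑ l, born ψ.1 (N.effect l) = 1 := (teleportation n).sum_law ψ N
  rw [Finset.sum_sub_distrib, ← Finset.mul_sum, ← Finset.mul_sum, ← Finset.sum_mul, hborn,
    N.sum_trace, ← Scheme.mass] at hsum
  have hinv : (3 / 16 * h)⁻¹ * (2 ^ n * D) ≤ h / 6 := by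
    rw [inv_mul_le_iff₀ (by positivity)]
    linarith
  linarith

end description


/-! ### Bounds on the average communication -/

variable {n : ℕ}

/-- The claim amounts to `(7 / 2 - n) * 2 ^ n < n + 19 / 4`, which is clear for `n ≥ 4` and checked
directly below that. For `n ≤ 3` the coordinate saved by fixing the phase is essential. -/
lemma coordCount_bound (n : ℕ) :
    (coordCount n * (n + 4) + coordCount n * (3 / 4) : ℝ) < (3 * n + 6) * 2 ^ n := by
  have h1 : (coordCount n : ℝ) = 2 * 2 ^ n - 1 :=
    eq_sub_of_add_eq (by exact_mod_cast coordCount_add_one n)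
  rw [h1]
  rcases n with _ | _ | _ | _ | n
  · norm_num
  · norm_num
  · norm_num
  · norm_num
  · have h2 : (0 : ℝ) < 2 ^ (n + 4) := by positivity
    push_cast
    nlinarith [Nat.cast_nonneg (α := ℝ) n]

/-- The bounds on the average communication in a protocol that teleports a state. -/
lemma avg_bits_lt {X : Type} {OA : X → Type} (A : LocalChoice X (PureState (Qubits n)) OA) (x : X)
    (N : POVM (Qubits n)) :
    ((teleportation n).protocol A).avgBits x N < (3 * n + 6) * 2 ^ n + 2 ∧
    ((teleportation n).protocol A).avgAliceBits x N < (3 * n + 6) * 2 ^ n ∧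
    ((teleportation n).protocol A).avgBobBits x N < 2 := by
  have hc := converges_teleportation n
  have halice : ((teleportation n).first : ℝ≥0∞) +
      (teleportation n).gap * ENNReal.ofReal (2 * (3 / 8)) < (3 * n + 6) * 2 ^ n := by
    have h1 : ((teleportation n).first : ℝ≥0∞) +
        (teleportation n).gap * ENNReal.ofReal (2 * (3 / 8)) =
        ENNReal.ofReal (coordCount n * (n + 4) + coordCount n * (3 / 4)) := by
      rw [ENNReal.ofReal_add (by positivity) (by positivity),
        ENNReal.ofReal_mul (p := (coordCount n : ℝ)) (q := 3 / 4) (by positivity),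
        ENNReal.ofReal_natCast,
        show (coordCount n * (n + 4) : ℝ) = ((coordCount n * (n + 4) : ℕ) : ℝ) by push_cast; rfl,
        ENNReal.ofReal_natCast, show (2 * (3 / 8) : ℝ) = 3 / 4 by norm_num]
      rfl
    have h2 : ((3 * n + 6) * 2 ^ n : ℝ≥0∞) = ENNReal.ofReal ((3 * n + 6) * 2 ^ n) := by
      rw [show ((3 * n + 6) * 2 ^ n : ℝ) = (((3 * n + 6) * 2 ^ n : ℕ) : ℝ) by push_cast; rfl,
        ENNReal.ofReal_natCast]
      push_cast
      rfl
    rw [h1, h2]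
    exact (ENNReal.ofReal_lt_ofReal_iff (by positivity)).2 (coordCount_bound n)
  have hbob : (1 : ℝ≥0∞) + ENNReal.ofReal (2 * (3 / 8)) < 2 := by
    rw [← ENNReal.ofReal_one, ← ENNReal.ofReal_add (by norm_num) (by norm_num),
      ENNReal.ofReal_lt_iff_lt_toReal (by norm_num) (by norm_num)]
    norm_num
  exact ⟨(hc.avgBits_le (by norm_num) A x N).trans_lt (ENNReal.add_lt_add halice hbob),
    (hc.avgAliceBits_le (by norm_num) A x N).trans_lt halice,
    (hc.avgBobBits_le (by norm_num) A x N).trans_lt hbob⟩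

/-! ### Teleportation -/

/-- Alice describes the state that she is given. -/
def describeInput (n : ℕ) :
    LocalChoice (PureState (Qubits n)) (PureState (Qubits n)) (fun _ => Unit) where
  size _ := 1
  choice _ _ := 0
  measurable_choice _ := measurable_const
  state ψ _ := ψ
  out _ _ := ()

lemma simulates_teleportationLaw (n : ℕ) :
    ((teleportation n).protocol (describeInput n)).Simulates (teleportationLaw n) := by
  refine fun ψ N => ⟨(converges_teleportation n).ae_ends _ ψ N, fun a l => ?_⟩
  rw [(converges_teleportation n).prob_outputs]
  have h : ∀ j : Fin ((describeInput n).size ψ),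
      uniform.real {r | (describeInput n).choice ψ r = j} = 1 := by
    intro j
    rw [show {r | (describeInput n).choice ψ r = j} = Set.univ from
      Set.eq_univ_of_forall fun r => Subsingleton.elim (α := Fin 1) _ _, probReal_univ]
  simp_rw [h, one_mul]
  exact Fintype.sum_unique (ι := Fin 1) fun _ => born ψ.1 (N.effect l)

/-! ### Entanglement simulation -/

lemma ebits_apply (a b : Qubits n) :
    ebits n (a, b) = if a = b then (1 / (Real.sqrt 2 : ℂ)) ^ n else 0 := by
  split_ifs with h
  · subst h
    simp [ebits, bellAmplitude]
  · obtain ⟨i, hi⟩ := Function.ne_iff.1 h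
    exact Finset.prod_eq_zero (Finset.mem_univ i) (if_neg hi)

/-- A measurement of `n` ebits steers Bob's qubits to the rows of a square root of the effect. -/
lemma born_ebits (C B : Matrix (Qubits n) (Qubits n) ℂ) :
    born (ebits n) ((C.conjTranspose * C) ⊗ₖ B) = (∑ i, born (C i) B) / 2 ^ n := by
  have hc : star ((1 / (Real.sqrt 2 : ℂ)) ^ n) * (1 / (Real.sqrt 2 : ℂ)) ^ n =
      (((1 / 2 ^ n : ℝ)) : ℂ) := by
    rw [star_pow, ← mul_pow]
    have : star (1 / (Real.sqrt 2 : ℂ)) * (1 / (Real.sqrt 2 : ℂ)) = 1 / 2 := by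
      rw [Complex.star_def, map_div₀, map_one, Complex.conj_ofReal, div_mul_div_comm, one_mul,
        ← Complex.ofReal_mul, Real.mul_self_sqrt (by norm_num)]
      norm_num
    rw [this]
    push_cast
    rw [one_div_pow]
  have h : star (ebits n) ⬝ᵥ ((C.conjTranspose * C) ⊗ₖ B).mulVec (ebits n) =
      ((1 / 2 ^ n : ℝ) : ℂ) * ∑ i, star (C i) ⬝ᵥ B.mulVec (C i) := by
    -- `ebits n` is `z` times the indicator of the diagonal, so both double sums over basis labels
    -- collapse to single ones.
    set z : ℂ := (1 / (Real.sqrt 2 : ℂ)) ^ n with hz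
    have hstar : ∀ a b, star (ebits n (a, b)) = if a = b then star z else 0 := fun a b => by
      rw [ebits_apply, apply_ite star, star_zero]
    have hmul : ∀ a b, ((C.conjTranspose * C) ⊗ₖ B).mulVec (ebits n) (a, b) =
        ∑ c, ∑ i, star (C i a) * C i c * B b c * z := fun a b => by
      simp only [Matrix.mulVec, dotProduct, Fintype.sum_prod_type, ebits_apply, mul_ite, mul_zero,
        Finset.sum_ite_eq, Finset.mem_univ, if_true, Matrix.kroneckerMap_apply]
      simp only [Matrix.mul_apply, Matrix.conjTranspose_apply, Finset.sum_mul, hz]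
    have hleft : star (ebits n) ⬝ᵥ ((C.conjTranspose * C) ⊗ₖ B).mulVec (ebits n) =
        ∑ a, ∑ c, ∑ i, star z * (star (C i a) * C i c * B a c * z) := by
      simp only [dotProduct, Fintype.sum_prod_type, Pi.star_apply, hstar, hmul, ite_mul, zero_mul,
        Finset.sum_ite_eq, Finset.mem_univ, if_true]
      simp only [Finset.mul_sum]
    rw [hleft, ← hc]
    simp only [dotProduct, Matrix.mulVec, Pi.star_apply, Finset.mul_sum]
    refine Eq.trans ?_ Finset.sum_comm
    refine Finset.sum_congr rfl fun a _ => ?_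
    rw [Finset.sum_comm]
    refine Finset.sum_congr rfl fun i _ => Finset.sum_congr rfl fun c _ => ?_
    ring
  rw [born, h, Complex.re_ofReal_mul, Complex.re_sum, one_div, ← div_eq_inv_mul]
  rfl

/-! ### Rank-one refinement of Alice's measurement -/

namespace POVM

variable (M : POVM (Qubits n))

/-- A square root of a POVM element. -/
noncomputable def root (k : Fin M.outcomes) : Matrix (Qubits n) (Qubits n) ℂ :=
  (exists_eq_conjTranspose_mul_self (M.posSemidef k)).choose

lemma effect_eq (k : Fin M.outcomes) :
    M.effect k = (M.root k).conjTranspose * M.root k :=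
  (exists_eq_conjTranspose_mul_self (M.posSemidef k)).choose_spec

/-- The outcomes of the refinement of a POVM into rank one elements. -/
abbrev Fine : Type := Fin M.outcomes × Qubits n

/-- The squared length of the vector of a rank one element. -/
noncomputable def weight (p : M.Fine) : ℝ := ∑ j, ‖M.root p.1 p.2 j‖ ^ 2

lemma weight_nonneg (p : M.Fine) : 0 ≤ M.weight p := Finset.sum_nonneg fun _ _ => sq_nonneg _

lemma sum_weight : ∑ p, M.weight p = 2 ^ n := by
  rw [← M.sum_trace, Fintype.sum_prod_type]
  refine Finset.sum_congr rfl fun k _ => ?_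
  rw [M.effect_eq, trace_gram]
  rfl

/-- The state to which Bob's qubits are steered by a rank one element. -/
noncomputable def steered (p : M.Fine) : PureState (Qubits n) :=
  -- A zero row has weight 0, so the basis state assigned to it is immaterial. The other rows are
  -- used without conjugation, since steering conjugates the vector of the rank-one element.
  if h : WithLp.toLp 2 (M.root p.1 p.2) = 0 then
    ⟨EuclideanSpace.single 0 1, by simp⟩
  else ⟨((‖WithLp.toLp 2 (M.root p.1 p.2)‖⁻¹ : ℝ) : ℂ) • WithLp.toLp 2 (M.root p.1 p.2), by
    rw [norm_smul, Complex.norm_real, norm_inv, norm_norm, inv_mul_cancel₀ (norm_ne_zero_iff.2 h)]⟩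

lemma weight_mul_born (p : M.Fine) (B : Matrix (Qubits n) (Qubits n) ℂ) :
    M.weight p * born (M.steered p).1 B = born (M.root p.1 p.2) B := by
  have hw : M.weight p = ‖WithLp.toLp 2 (M.root p.1 p.2)‖ ^ 2 := by
    rw [EuclideanSpace.norm_sq_eq]
    rfl
  unfold steered
  split_ifs with h
  · have h0 : M.root p.1 p.2 = 0 := by
      simpa using h
    rw [hw, h, h0]
    simp [born]
  · rw [WithLp.ofLp_smul, born_smul, hw, Complex.norm_real, norm_inv, norm_norm, ← mul_assoc,
      ← mul_pow, mul_inv_cancel₀ (norm_ne_zero_iff.2 h), one_pow, one_mul]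

lemma card_fine_pos : 0 < Fintype.card M.Fine := by
  have : Nonempty (Fin M.outcomes) := ⟨⟨0, M.outcomes_pos⟩⟩
  exact Fintype.card_pos

/-- The probability of an outcome of the refined measurement. -/
noncomputable def fineProb (j : Fin (Fintype.card M.Fine)) : ℝ :=
  M.weight ((Fintype.equivFin M.Fine).symm j) / 2 ^ n

end POVM

/-- Alice performs a rank one refinement of her measurement and describes the state to which Bob's
qubits are steered. -/
noncomputable def steer (n : ℕ) :
    LocalChoice (POVM (Qubits n)) (PureState (Qubits n)) (fun M => Fin M.outcomes) where
  size M := Fintype.card M.Fine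
  choice M := sample M.card_fine_pos 0 M.fineProb
  measurable_choice _ := measurable_sample _ _ _
  state M j := M.steered ((Fintype.equivFin M.Fine).symm j)
  out M j := ((Fintype.equivFin M.Fine).symm j).1

/-- The probability of a refined outcome times the Born probability in its steered state is the Born
value of the unnormalised row over `2 ^ n`. Summing over the rows that refine outcome `k` gives
`born_ebits`. -/
lemma simulates_ebitLaw (n : ℕ) :
    ((teleportation n).protocol (steer n)).Simulates (ebitLaw n) := by
  refine fun M N => ⟨(converges_teleportation n).ae_ends _ M N, fun k l => ?_⟩
  have hw : ∀ j, 0 ≤ M.fineProb j := fun j => div_nonneg (M.weight_nonneg _) (by positivity)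
  have hs : ∑ j, M.fineProb j = 1 := by
    refine ((Fintype.equivFin M.Fine).symm.sum_comp fun p => M.weight p / 2 ^ n).trans ?_
    rw [← Finset.sum_div,
      M.sum_weight, div_self (by positivity)]
  rw [(converges_teleportation n).prob_outputs, Finset.sum_filter]
  have h : ∀ j : Fin (Fintype.card M.Fine),
      uniform.real {r | (steer n).choice M r = j} *
        (teleportation n).law ((steer n).state M j) N l =
      born (M.root ((Fintype.equivFin M.Fine).symm j).1 ((Fintype.equivFin M.Fine).symm j).2)
        (N.effect l) / 2 ^ n := by
    intro j
    have : uniform.real {r | (steer n).choice M r = j} = M.fineProb j := by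
      rw [measureReal_def]
      exact (congrArg ENNReal.toReal (uniform_sample M.card_fine_pos hw hs j)).trans
        (ENNReal.toReal_ofReal (hw j))
    rw [this, ← M.weight_mul_born, POVM.fineProb, div_mul_eq_mul_div]
    rfl
  calc ∑ j, (if (steer n).out M j = k then uniform.real {r | (steer n).choice M r = j} *
        (teleportation n).law ((steer n).state M j) N l else 0)
      = ∑ j, (fun p : M.Fine => if p.1 = k then born (M.root p.1 p.2) (N.effect l) / 2 ^ n else 0)
          ((Fintype.equivFin M.Fine).symm j) :=
        Finset.sum_congr rfl fun j _ => by rw [h j]; rfl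
    _ = ∑ p : M.Fine, if p.1 = k then born (M.root p.1 p.2) (N.effect l) / 2 ^ n else 0 :=
        (Fintype.equivFin M.Fine).symm.sum_comp
          fun p : M.Fine => if p.1 = k then born (M.root p.1 p.2) (N.effect l) / 2 ^ n else 0
    _ = (∑ i, born (M.root k i) (N.effect l)) / 2 ^ n := by
        rw [Fintype.sum_prod_type, Finset.sum_eq_single k]
        · simp [Finset.sum_div]
        · intro b _ hb
          simp [hb]
        · simp
    _ = ebitLaw n M N k l := by rw [ebitLaw, M.effect_eq k, born_ebits]

end ClassicalSimulation

open ClassicalSimulation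
theorem theorem3 (n : ℕ) :
    (∃ p : TeleportationProtocol n,
      p.Simulates (teleportationLaw n) ∧
      ∀ (ψ : PureState (Qubits n)) (N : POVM (Qubits n)),
        p.avgBits ψ N < (3 * n + 6) * 2 ^ n + 2 ∧
        p.avgAliceBits ψ N < (3 * n + 6) * 2 ^ n ∧
        p.avgBobBits ψ N < 2) ∧
    (∃ p : EbitProtocol n,
      p.Simulates (ebitLaw n) ∧
      ∀ (M N : POVM (Qubits n)),
        p.avgBits M N < (3 * n + 6) * 2 ^ n + 2 ∧
        p.avgAliceBits M N < (3 * n + 6) * 2 ^ n ∧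
        p.avgBobBits M N < 2) :=
  ⟨⟨(teleportation n).protocol (describeInput n), simulates_teleportationLaw n,
      fun ψ N => avg_bits_lt _ ψ N⟩,
    ⟨(teleportation n).protocol (steer n), simulates_ebitLaw n, fun M N => avg_bits_lt _ M N⟩⟩
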